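/- **Setting.** *TW-trees* are (isomorphism classes of) rooted trees whose nodes are coloured meagre or fat, such that all leaves are meagre and every fat node has exactly one child. $|\tau|$ is the number of nodes of $\tau$ and $\sigma(\tau)$ the order of its symmetry group. A sub-tree of $\tau$ consists of a node and all its descendants; a tree is linear if no node has more than one child. For $k\ge 0$, $TK(k)$ is the set of TW-trees in which no linear sub-tree of order at most $k$ has a fat root, and $\mathrm{rec}_k(\tau)$ is the TW-tree obtained from $\tau$ by recolouring as meagre all nodes of its linear sub-trees of order at most $k$. For $f:\mathbb{R}^N\to\mathbb{R}^N$ smooth near $y$ and $\mathbf{A}\in\mathbb{R}^{N\times N}$, the elementary differential $F(\tau)(y)$ is $f^{(m)}(y)\big(F(\tau_1)(y),\dots,F(\tau_m)(y)\big)$ if the root is meagre with sub-trees $\tau_1,\dots,\tau_m$ at its children, and $\mathbf{A}F(\tau_1)(y)$ if the root is fat. A function $u(h)$ has the B-series with coefficients $\mathsf{a}$ over a set $S$ of TW-trees if for every $p\ge 0$ $$u(h)=\mathsf{a}(\emptyset)\,y+\sum_{\tau\in S,\ |\tau|\le p}\mathsf{a}(\tau)\frac{h^{|\tau|}}{\sigma(\tau)}F(\tau)(y)+O(h^{p+1})\qquad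 (h\to0).$$ An $s$-stage EPIRK method ($s\ge1$) has real coefficients $a_{i,j},b_j,g_{i,j}$ and functions $\psi_{i,j}=\sum_{k=1}^{s}p_{i,j,k}\varphi_k$ with $\varphi_k(z)=\sum_{l\ge0}z^l/(l+k)!$. With a matrix $\mathbf{A}$ in place of the Jacobian, one step of size $h$ from $y_n$ is $$Y_i=y_n+a_{i,1}\psi_{i,1}(g_{i,1}h\mathbf{A})hf(y_n)+\sum_{j=2}^{i}a_{i,j}\psi_{i,j}(g_{i,j}h\mathbf{A})h\Delta^{(j-1)}r(y_n),\quad 1\le i\le s-1,$$ $$y_{n+1}=y_n+b_1\psi_{s,1}(g_{s,1}h\mathbf{A})hf(y_n)+\sum_{j=2}^{s}b_j\psi_{s,j}(g_{s,j}h\mathbf{A})h\Delta^{(j-1)}r(y_n),$$ where $r(y)=f(y)-f(y_n)-\mathbf{A}(y-y_n)$ and $\Delta^{(j)}r(y_n)$ is the $j$-th forward difference at index $0$ of $r(Y_0),r(Y_1),\dots$, with $Y_0=y_n$. **Theorem.** For every EPIRK method there are coefficients $\mathsf{a}$ on the TW-trees and the empty tree, depending only on the method, such that for all $N$, all $f$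 smooth near $y_n$ and all $\mathbf{A}\in\mathbb{R}^{N\times N}$, the numerical solution $y_{n+1}$ has the B-series with coefficients $\mathsf{a}$ over all TW-trees. Moreover let $M\ge0$. 1. Let $\mathbf{J}_n=f'(y_n)$, $f_n=f(y_n)$, let $\mathbf{V}\in\mathbb{R}^{N\times M}$ have orthonormal columns spanning $\mathrm{span}\{f_n,\mathbf{J}_nf_n,\dots,\mathbf{J}_n^{M-1}f_n\}$, and let $\mathbf{A}=\mathbf{A}_n=\mathbf{V}\mathbf{H}\mathbf{V}^T$ with $\mathbf{H}=\mathbf{V}^T\mathbf{J}_n\mathbf{V}$. Then $y_{n+1}$ has a B-series over the trees of $TK(M)$ only. Its coefficients $\mathsf{b}$ are $\mathsf{b}(\emptyset)=\mathsf{a}(\emptyset)$ and $$\frac{\mathsf{b}(\tau)}{\sigma(\tau)}=\sum_{\theta\in TW:\ \mathrm{rec}_M(\theta)=\tau}\frac{\mathsf{a}(\theta)}{\sigma(\theta)} ,$$ so every TW-tree merges with its recolouring; and $F(\mathrm{rec}_M(\tau))(y_n)=F(\tau)(y_n)$ for every TW-tree $\tau$. 2. For every TW-tree $\tau$: $\mathrm{rec}_M(\tau)\in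 TK(M)$; $\tau\in TK(M)$ if and only if $\mathrm{rec}_M(\tau)=\tau$; and if $\tau$ is linear with $|\tau|\le M$, then all nodes of $\mathrm{rec}_M(\tau)$ are meagre. -/

import Mathlib

open Filter Topology Asymptotics
open scoped ContDiff

noncomputable section

namespace EPIRK

universe u

/-- Symmetry of the higher derivatives of a smooth function under exchanging adjacent arguments. -/
theorem iteratedFDeriv_comp_swap {E : Type u} [NormedAddCommGroup E] [NormedSpace ℝ E] (n : ℕ) :
    ∀ {F : Type u} [NormedAddCommGroup F] [NormedSpace ℝ F] (f : E → F) (y : E),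
      ContDiffAt ℝ (n + 1 : ℕ) f y → ∀ (i : Fin n) (v : Fin (n + 1) → E),
      iteratedFDeriv ℝ (n + 1) f y (v ∘ Equiv.swap i.castSucc i.succ) =
        iteratedFDeriv ℝ (n + 1) f y v := by
  induction n with
  | zero => exact fun _ _ _ i => i.elim0
  | succ n ih =>
    intro F _ _ f y hf i v
    induction i using Fin.cases with
    | succ j =>
      have hd : DifferentiableAt ℝ (iteratedFDeriv ℝ (n + 1) f) y :=
        hf.differentiableAt_iteratedFDeriv (by exact_mod_cast Nat.lt_succ_self _)
      rw [hd.iteratedFDeriv_succ_apply_left', hd.iteratedFDeriv_succ_apply_left']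
      have hσ : Fin.tail (v ∘ Equiv.swap j.succ.castSucc j.succ.succ) =
          Fin.tail v ∘ Equiv.swap j.castSucc j.succ := by
        funext l
        simp only [Fin.tail, Function.comp_apply, ← Fin.succ_castSucc]
        rw [(Fin.succ_injective _).swap_apply]
      have h0 : (v ∘ Equiv.swap j.succ.castSucc j.succ.succ) 0 = v 0 := by
        rw [Function.comp_apply, Equiv.swap_apply_of_ne_of_ne]
        · rw [← Fin.succ_castSucc]; exact (Fin.succ_ne_zero _).symm
        · exact (Fin.succ_ne_zero _).symm
      rw [hσ, h0]
      congr 1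
      refine Filter.EventuallyEq.fderiv_eq ?_
      filter_upwards [hf.eventually (by simp)] with z hz
      exact ih f z (hz.of_le (by exact_mod_cast Nat.le_succ _)) j _
    | zero =>
      cases n with
      | zero =>
        have h2 : IsSymmSndFDerivAt ℝ f y := hf.isSymmSndFDerivAt (by simp)
        have hv : v = ![v 0, v 1] := by
          ext l; fin_cases l <;> rfl
        have hv' : v ∘ Equiv.swap (0 : Fin 1).castSucc (0 : Fin 1).succ = ![v 1, v 0] := by
          ext l; fin_cases l <;> simp
        rw [hv']
        conv_rhs => rw [hv]
        exact h2.iteratedFDeriv_cons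
      | succ n =>
        rw [iteratedFDeriv_succ_apply_right (n := n + 2), iteratedFDeriv_succ_apply_right (n := n + 2)]
        have hσ : Fin.init (v ∘ Equiv.swap (0 : Fin (n + 2)).castSucc (0 : Fin (n + 2)).succ) =
            Fin.init v ∘ Equiv.swap (0 : Fin (n + 1)).castSucc (0 : Fin (n + 1)).succ := by
          funext l
          simp only [Fin.init, Function.comp_apply]
          rw [← (Fin.castSucc_injective _).swap_apply]
          rfl
        have h0 : (v ∘ Equiv.swap (0 : Fin (n + 2)).castSucc (0 : Fin (n + 2)).succ)
            (Fin.last _) = v (Fin.last _) := by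
          rw [Function.comp_apply, Equiv.swap_apply_of_ne_of_ne]
          · exact (Fin.castSucc_lt_last _).ne'
          · simp [Fin.ext_iff]
        rw [hσ, h0, ih (fun z => fderiv ℝ f z) y (hf.fderiv_right (by norm_cast))]

/-- Symmetry of the higher derivatives of a smooth function. -/
theorem iteratedFDeriv_comp_perm {E F : Type u} [NormedAddCommGroup E] [NormedSpace ℝ E]
    [NormedAddCommGroup F] [NormedSpace ℝ F] (n : ℕ) (f : E → F) (y : E)
    (hf : ContDiffAt ℝ n f y) (σ : Equiv.Perm (Fin n)) (v : Fin n → E) :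
    iteratedFDeriv ℝ n f y (v ∘ σ) = iteratedFDeriv ℝ n f y v := by
  cases n with
  | zero => congr 1; exact Subsingleton.elim _ _
  | succ n =>
    have hσ : σ ∈ Submonoid.closure
        (Set.range fun i : Fin n => Equiv.swap i.castSucc i.succ) := by
      rw [Equiv.Perm.mclosure_swap_castSucc_succ]; trivial
    induction hσ using Submonoid.closure_induction generalizing v with
    | mem σ hσ =>
      obtain ⟨i, rfl⟩ := hσ
      exact iteratedFDeriv_comp_swap n f y hf i v
    | one => rfl
    | mul σ τ _ _ h1 h2 =>
      rw [Equiv.Perm.coe_mul, ← Function.comp_assoc, h2, h1]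

/-! ## Two-coloured rooted trees -/

/-- Rooted trees with meagre and fat nodes in which every fat node has exactly one child
(so that all leaves are meagre), with an ordering of the children of every node. -/
inductive PlaneTW : Type
  | meagre (n : ℕ) (ch : Fin n → PlaneTW) : PlaneTW
  | fat (t : PlaneTW) : PlaneTW

namespace PlaneTW

/-- The number of nodes. -/
def order : PlaneTW → ℕ
  | meagre _ ch => 1 + ∑ i, (ch i).order
  | fat t => 1 + t.order

/-- The colour-preserving isomorphisms of rooted trees (forgetting the order of the children):
a bijection between the children of the two roots, together with an isomorphism between the
sub-trees at corresponding children. -/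
def Isos : PlaneTW → PlaneTW → Type
  | meagre n ch, meagre n' ch' => Σ e : Fin n ≃ Fin n', ∀ i, Isos (ch i) (ch' (e i))
  | fat t, fat t' => Isos t t'
  | meagre _ _, fat _ => Empty
  | fat _, meagre _ _ => Empty

/-- The order of the symmetry group of a tree. -/
def symm (t : PlaneTW) : ℕ := Nat.card (Isos t t)

/-- Every node has at most one child. -/
def IsLinear : PlaneTW → Prop
  | meagre n ch => n ≤ 1 ∧ ∀ i, (ch i).IsLinear
  | fat t => t.IsLinear

/-- The root is fat. -/
def FatRoot : PlaneTW → Prop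
  | meagre _ _ => False
  | fat _ => True

/-- All nodes are meagre. -/
def AllMeagre : PlaneTW → Prop
  | meagre _ ch => ∀ i, (ch i).AllMeagre
  | fat _ => False

/-- `IsSubtree s t`: `s` is the sub-tree of `t` formed by some node and all its descendants. -/
inductive IsSubtree (s : PlaneTW) : PlaneTW → Prop
  | refl : IsSubtree s s
  | meagre {n : ℕ} {ch : Fin n → PlaneTW} (i : Fin n) (h : IsSubtree s (ch i)) :
      IsSubtree s (meagre n ch)
  | fat {t : PlaneTW} (h : IsSubtree s t) : IsSubtree s (fat t)

/-- No linear sub-tree of order at most `k` has a fat root. -/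
def IsTK (k : ℕ) (t : PlaneTW) : Prop :=
  ∀ s, IsSubtree s t → s.IsLinear → s.order ≤ k → ¬ s.FatRoot

open Classical in
/-- Recolour as meagre all nodes of the linear sub-trees of order at most `k`. -/
def recolour (k : ℕ) : PlaneTW → PlaneTW
  | meagre n ch => meagre n fun i => (ch i).recolour k
  | fat t =>
      if (fat t).IsLinear ∧ (fat t).order ≤ k then meagre 1 fun _ => t.recolour k
      else fat (t.recolour k)

/-- The elementary differential `F(t)(y)`: meagre nodes stand for `f` and its derivatives at `y`,
fat nodes for the matrix `A`. -/
def elemDiff {E : Type*} [NormedAddCommGroup E] [NormedSpace ℝ E]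
    (f : E → E) (A : E →L[ℝ] E) (y : E) : PlaneTW → E
  | meagre n ch => iteratedFDeriv ℝ n f y fun i => (ch i).elemDiff f A y
  | fat t => A (t.elemDiff f A y)

/-- Equality of trees up to the order of the children. -/
def Iso (t t' : PlaneTW) : Prop := Nonempty (Isos t t')

theorem iso_meagre {n n' : ℕ} {ch : Fin n → PlaneTW} {ch' : Fin n' → PlaneTW} :
    Iso (meagre n ch) (meagre n' ch') ↔ ∃ e : Fin n ≃ Fin n', ∀ i, Iso (ch i) (ch' (e i)) := by
  unfold Iso
  constructor
  · rintro ⟨e, h⟩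
    exact ⟨e, fun i => ⟨h i⟩⟩
  · rintro ⟨e, h⟩
    exact ⟨⟨e, fun i => (h i).some⟩⟩

theorem iso_fat {t t' : PlaneTW} : Iso (fat t) (fat t') ↔ Iso t t' := Iff.rfl

theorem not_iso_meagre_fat {n : ℕ} {ch : Fin n → PlaneTW} {t : PlaneTW} :
    ¬ Iso (meagre n ch) (fat t) := fun ⟨h⟩ => nomatch (show Empty from h)

theorem not_iso_fat_meagre {n : ℕ} {ch : Fin n → PlaneTW} {t : PlaneTW} :
    ¬ Iso (fat t) (meagre n ch) := fun ⟨h⟩ => nomatch (show Empty from h)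

theorem Iso.refl : ∀ t, Iso t t := by
  intro t
  induction t with
  | meagre n ch ih => exact iso_meagre.2 ⟨Equiv.refl _, ih⟩
  | fat t ih => exact iso_fat.2 ih

theorem Iso.symm' : ∀ {t t'}, Iso t t' → Iso t' t := by
  intro t
  induction t with
  | meagre n ch ih =>
    rintro (⟨n', ch'⟩ | t') h
    · obtain ⟨e, he⟩ := iso_meagre.1 h
      refine iso_meagre.2 ⟨e.symm, fun i => ih _ ?_⟩
      simpa using he (e.symm i)
    · exact (not_iso_meagre_fat h).elim
  | fat t ih =>
    rintro (⟨n', ch'⟩ | t') h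
    · exact (not_iso_fat_meagre h).elim
    · exact iso_fat.2 (ih (iso_fat.1 h))

theorem Iso.trans : ∀ {t t' t''}, Iso t t' → Iso t' t'' → Iso t t'' := by
  intro t
  induction t with
  | meagre n ch ih =>
    rintro (⟨n', ch'⟩ | t') (⟨n'', ch''⟩ | t'') h h'
    · obtain ⟨e, he⟩ := iso_meagre.1 h
      obtain ⟨e', he'⟩ := iso_meagre.1 h'
      exact iso_meagre.2 ⟨e.trans e', fun i => ih i (he i) (he' (e i))⟩
    · exact (not_iso_meagre_fat h').elim
    · exact (not_iso_meagre_fat h).elim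
    · exact (not_iso_meagre_fat h).elim
  | fat t ih =>
    rintro (⟨n', ch'⟩ | t') (⟨n'', ch''⟩ | t'') h h'
    · exact (not_iso_fat_meagre h).elim
    · exact (not_iso_fat_meagre h).elim
    · exact (not_iso_fat_meagre h').elim
    · exact iso_fat.2 (ih (iso_fat.1 h) (iso_fat.1 h'))

instance setoid : Setoid PlaneTW := ⟨Iso, Iso.refl, Iso.symm', Iso.trans⟩

theorem Iso.order_eq : ∀ {t t'}, Iso t t' → t.order = t'.order := by
  intro t
  induction t with
  | meagre n ch ih =>
    rintro (⟨n', ch'⟩ | t') h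
    · obtain ⟨e, he⟩ := iso_meagre.1 h
      simp only [order]
      rw [← Equiv.sum_comp e]
      exact congrArg _ (Finset.sum_congr rfl fun i _ => ih i (he i))
    · exact (not_iso_meagre_fat h).elim
  | fat t ih =>
    rintro (⟨n', ch'⟩ | t') h
    · exact (not_iso_fat_meagre h).elim
    · simp only [order, ih (iso_fat.1 h)]

theorem Iso.isLinear : ∀ {t t'}, Iso t t' → t.IsLinear → t'.IsLinear := by
  intro t
  induction t with
  | meagre n ch ih =>
    rintro (⟨n', ch'⟩ | t') h hl
    · obtain ⟨e, he⟩ := iso_meagre.1 h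
      refine ⟨by simpa [← Fin.equiv_iff_eq.1 ⟨e⟩] using hl.1, fun i => ?_⟩
      simpa using ih (e.symm i) (he _) (hl.2 _)
    · exact (not_iso_meagre_fat h).elim
  | fat t ih =>
    rintro (⟨n', ch'⟩ | t') h hl
    · exact (not_iso_fat_meagre h).elim
    · exact ih (t' := t') h hl

theorem Iso.allMeagre : ∀ {t t'}, Iso t t' → t.AllMeagre → t'.AllMeagre := by
  intro t
  induction t with
  | meagre n ch ih =>
    rintro (⟨n', ch'⟩ | t') h hl
    · obtain ⟨e, he⟩ := iso_meagre.1 h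
      intro i
      simpa using ih (e.symm i) (he _) (hl _)
    · exact (not_iso_meagre_fat h).elim
  | fat t ih => exact fun _ hl => hl.elim

theorem Iso.fatRoot : ∀ {t t'}, Iso t t' → t.FatRoot → t'.FatRoot
  | meagre _ _, _, _, h => h.elim
  | fat _, meagre _ _, h, _ => (not_iso_fat_meagre h).elim
  | fat _, fat _, _, _ => trivial

theorem Iso.isSubtree : ∀ {t t'}, Iso t t' → ∀ {s}, IsSubtree s t →
    ∃ s', Iso s s' ∧ IsSubtree s' t' := by
  intro t t' h s hs
  induction hs generalizing t' with
  | refl => exact ⟨t', h, .refl⟩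
  | @meagre n ch i hi ih =>
    rcases t' with ⟨n', ch'⟩ | t'
    · obtain ⟨e, he⟩ := iso_meagre.1 h
      obtain ⟨s', h1, h2⟩ := ih (he i)
      exact ⟨s', h1, .meagre _ h2⟩
    · exact (not_iso_meagre_fat h).elim
  | fat hi ih =>
    rcases t' with ⟨n', ch'⟩ | t'
    · exact (not_iso_fat_meagre h).elim
    · obtain ⟨s', h1, h2⟩ := ih (iso_fat.1 h)
      exact ⟨s', h1, .fat h2⟩

theorem Iso.isTK {k : ℕ} {t t'} (h : Iso t t') (ht : t.IsTK k) : t'.IsTK k := by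
  intro s' hs' hl ho hf
  obtain ⟨s, h1, h2⟩ := h.symm'.isSubtree hs'
  exact ht s h2 (h1.isLinear hl) (h1.order_eq ▸ ho) (h1.fatRoot hf)

theorem Iso.recolour (k : ℕ) : ∀ {t t'}, Iso t t' → Iso (t.recolour k) (t'.recolour k) := by
  intro t
  induction t with
  | meagre n ch ih =>
    rintro (⟨n', ch'⟩ | t') h
    · obtain ⟨e, he⟩ := iso_meagre.1 h
      exact iso_meagre.2 ⟨e, fun i => ih i (he i)⟩
    · exact (not_iso_meagre_fat h).elim
  | fat t ih =>
    rintro (⟨n', ch'⟩ | t') h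
    · exact (not_iso_fat_meagre h).elim
    · have hl : (PlaneTW.fat t).IsLinear ↔ (PlaneTW.fat t').IsLinear := ⟨h.isLinear, h.symm'.isLinear⟩
      have := ih (iso_fat.1 h)
      simp only [PlaneTW.recolour]
      by_cases hc : (PlaneTW.fat t).IsLinear ∧ (PlaneTW.fat t).order ≤ k
      · rw [if_pos hc, if_pos (by rwa [← hl, ← h.order_eq])]
        exact iso_meagre.2 ⟨Equiv.refl _, fun _ => this⟩
      · rw [if_neg hc, if_neg (by rwa [← hl, ← h.order_eq])]
        exact iso_fat.2 this

theorem Iso.nonempty_equiv : ∀ {s s' t t'}, Iso s s' → Iso t t' →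
    Nonempty (Isos s t ≃ Isos s' t') := by
  intro s
  induction s with
  | meagre n ch ih =>
    rintro (⟨n', ch'⟩ | s') (⟨m, dh⟩ | t) (⟨m', dh'⟩ | t') h h'
    · obtain ⟨e, he⟩ := iso_meagre.1 h
      obtain ⟨d, hd⟩ := iso_meagre.1 h'
      refine ⟨Equiv.sigmaCongr (Equiv.equivCongr e d) fun u => Equiv.piCongr e fun i => ?_⟩
      refine (ih i (he i) ?_).some
      simpa using hd (u i)
    · exact (not_iso_meagre_fat h').elim
    · exact (not_iso_fat_meagre h').elim
    · exact ⟨Equiv.refl Empty⟩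
    all_goals exact (not_iso_meagre_fat h).elim
  | fat s ih =>
    rintro (⟨n', ch'⟩ | s') (⟨m, dh⟩ | t) (⟨m', dh'⟩ | t') h h'
    any_goals exact (not_iso_fat_meagre h).elim
    · exact ⟨Equiv.refl Empty⟩
    · exact (not_iso_meagre_fat h').elim
    · exact (not_iso_fat_meagre h').elim
    · exact ih (s' := s') (t := t) (t' := t') h h'

theorem Iso.symm_eq {t t'} (h : Iso t t') : t.symm = t'.symm :=
  Nat.card_congr (h.nonempty_equiv h).some

theorem order_pos (t : PlaneTW) : 0 < t.order := by
  cases t <;> simp only [order] <;> omega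

theorem finite_order_le (n : ℕ) : {t : PlaneTW | t.order ≤ n}.Finite := by
  induction n with
  | zero =>
    convert Set.finite_empty
    ext t
    simpa using (order_pos t).ne'
  | succ n ih =>
    have h1 : (⋃ k ∈ Finset.range (n + 1),
        (meagre k) '' (Set.univ.pi fun _ : Fin k => {t : PlaneTW | t.order ≤ n})).Finite :=
      Set.Finite.biUnion (Finset.finite_toSet _) fun k _ =>
        (Set.Finite.pi fun _ => ih).image _
    refine (h1.union (ih.image fat)).subset ?_
    rintro (⟨k, ch⟩ | t) ht
    · left
      simp only [Set.mem_ofPred_eq, order] at ht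
      have hk : k ≤ ∑ i, (ch i).order := by
        simpa using Finset.sum_le_sum (s := Finset.univ) (f := fun _ => 1)
          (g := fun i => (ch i).order) fun (i : Fin k) _ => order_pos (ch i)
      simp only [Set.mem_iUnion]
      refine ⟨k, by simp; omega, ch, fun i _ => ?_, rfl⟩
      have := Finset.single_le_sum (f := fun i => (ch i).order) (fun _ _ => Nat.zero_le _)
        (Finset.mem_univ i)
      simp only [Set.mem_ofPred_eq]
      omega
    · right
      simp only [Set.mem_ofPred_eq, order] at ht
      exact ⟨t, by simp only [Set.mem_ofPred_eq]; omega, rfl⟩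

/-- For smooth `f` the elementary differential does not depend on the order of the children. -/
theorem Iso.elemDiff_eq {E : Type*} [NormedAddCommGroup E] [NormedSpace ℝ E]
    {f : E → E} {y : E} (hf : ContDiffAt ℝ ∞ f y) (A : E →L[ℝ] E) :
    ∀ {t t'}, Iso t t' → t.elemDiff f A y = t'.elemDiff f A y := by
  intro t
  induction t with
  | meagre n ch ih =>
    rintro (⟨n', ch'⟩ | t') h
    · obtain ⟨e, he⟩ := iso_meagre.1 h
      obtain rfl := Fin.equiv_iff_eq.1 ⟨e⟩
      simp only [elemDiff]
      have hf' : ContDiffAt ℝ n f y := hf.of_le (by exact_mod_cast le_top)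
      rw [← iteratedFDeriv_comp_perm n f y hf' e fun i => elemDiff f A y (ch' i)]
      congr 1
      ext1 i
      exact ih i (he i)
    · exact (not_iso_meagre_fat h).elim
  | fat t ih =>
    rintro (⟨n', ch'⟩ | t') h
    · exact (not_iso_fat_meagre h).elim
    · simp only [elemDiff, ih (iso_fat.1 h)]

end PlaneTW

/-- TW-trees: isomorphism classes of rooted trees with meagre and fat nodes, where leaves are
meagre and fat nodes are singly branched. -/
def TW : Type := Quotient PlaneTW.setoid

namespace TW

/-- The number of nodes `|τ|`. -/
def order : TW → ℕ := Quotient.lift PlaneTW.order fun _ _ h => h.order_eq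

/-- The order `σ(τ)` of the symmetry group. -/
def symm : TW → ℕ := Quotient.lift PlaneTW.symm fun _ _ h => PlaneTW.Iso.symm_eq h

/-- Linear trees: no node has more than one child. -/
def IsLinear : TW → Prop := Quotient.lift PlaneTW.IsLinear fun _ _ h =>
  propext ⟨PlaneTW.Iso.isLinear h, PlaneTW.Iso.isLinear (PlaneTW.Iso.symm' h)⟩

/-- All nodes are meagre. -/
def AllMeagre : TW → Prop := Quotient.lift PlaneTW.AllMeagre fun _ _ h =>
  propext ⟨PlaneTW.Iso.allMeagre h, PlaneTW.Iso.allMeagre (PlaneTW.Iso.symm' h)⟩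

/-- The set `TK(k)` of TW-trees in which no linear sub-tree of order at most `k` has a fat root. -/
def TK (k : ℕ) : Set TW := Quotient.lift (PlaneTW.IsTK k) fun _ _ h =>
  propext ⟨PlaneTW.Iso.isTK h, PlaneTW.Iso.isTK (PlaneTW.Iso.symm' h)⟩

/-- Recolour as meagre all nodes of the linear sub-trees of order at most `k`. -/
def recolour (k : ℕ) : TW → TW :=
  Quotient.map (PlaneTW.recolour k) fun _ _ h => PlaneTW.Iso.recolour k h

/-- The elementary differential `F(τ)(y)`, computed from any ordering of the children; the choice
is irrelevant for smooth `f` by `PlaneTW.Iso.elemDiff_eq`. -/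
def elemDiff {E : Type*} [NormedAddCommGroup E] [NormedSpace ℝ E]
    (f : E → E) (A : E →L[ℝ] E) (y : E) (τ : TW) : E :=
  (Quotient.out τ).elemDiff f A y

theorem finite_order_le (n : ℕ) : {τ : TW | τ.order ≤ n}.Finite := by
  refine ((PlaneTW.finite_order_le n).image (Quotient.mk PlaneTW.setoid)).subset ?_
  intro τ hτ
  induction τ using Quotient.inductionOn with
  | h t => exact ⟨t, hτ, rfl⟩

/-- The finite set of TW-trees of order at most `n`. -/
def orderLE (n : ℕ) : Finset TW := (finite_order_le n).toFinset

end TW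

/-! ## B-series -/

open Classical in
/-- The B-series over the trees in `S`, truncated after the trees of order `p`:
`a(∅) y + ∑_{τ ∈ S, |τ| ≤ p} a(τ) h^|τ| / σ(τ) F(τ)(y)`; the empty tree is `none`. -/
def truncBSeries {E : Type*} [NormedAddCommGroup E] [NormedSpace ℝ E] (S : Set TW)
    (a : Option TW → ℝ) (f : E → E) (A : E →L[ℝ] E) (y : E) (p : ℕ) (h : ℝ) : E :=
  a none • y + ∑ τ ∈ (TW.orderLE p).filter (· ∈ S),
    (a (some τ) * h ^ τ.order / (τ.symm : ℝ)) • τ.elemDiff f A y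

/-- `u(h)` has, as an asymptotic (Taylor) series at `h = 0`, the B-series over the trees in `S`
with coefficients `a`. -/
def HasBSeries {E : Type*} [NormedAddCommGroup E] [NormedSpace ℝ E] (S : Set TW)
    (a : Option TW → ℝ) (f : E → E) (A : E →L[ℝ] E) (y : E) (u : ℝ → E) : Prop :=
  ∀ p : ℕ, (fun h => u h - truncBSeries S a f A y p h) =O[𝓝 0] fun h => h ^ (p + 1)

open Classical in
/-- The coefficients after merging every tree with its recolouring: the coefficient
`a(τ) / σ(τ)` in front of `h^|τ| F(τ)` is replaced by the sum of the coefficients `a(θ) / σ(θ)` of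
all TW-trees `θ` that become `τ` after recolouring (these have the same order as `τ`). -/
def mergedCoeff (k : ℕ) (a : Option TW → ℝ) : Option TW → ℝ
  | none => a none
  | some τ => τ.symm * ∑ θ ∈ (TW.orderLE τ.order).filter (fun θ => θ.recolour k = τ),
      a (some θ) / θ.symm

/-! ## The EPIRK method -/

/-- `φ_k(Z) = ∑_i Z^i / (i + k)!`. -/
def phi {E : Type*} [NormedAddCommGroup E] [NormedSpace ℝ E] (k : ℕ) (Z : E →L[ℝ] E) :
    E →L[ℝ] E :=
  ∑' i : ℕ, ((i + k).factorial : ℝ)⁻¹ • Z ^ i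

theorem summable_phi {E : Type*} [NormedAddCommGroup E] [NormedSpace ℝ E] [CompleteSpace E]
    (k : ℕ) (Z : E →L[ℝ] E) : Summable fun i : ℕ => ((i + k).factorial : ℝ)⁻¹ • Z ^ i := by
  have hs := (Real.summable_pow_div_factorial ‖Z‖).mul_left ‖(1 : E →L[ℝ] E)‖
  have hs1 := Real.summable_pow_div_factorial ‖Z‖
  refine Summable.of_norm_bounded_eventually_nat (g := fun i => ‖Z‖ ^ i / i.factorial) hs1 ?_
  filter_upwards [eventually_gt_atTop 0] with i hi
  rw [norm_smul, norm_inv, Real.norm_natCast, inv_mul_eq_div]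
  gcongr
  · exact norm_pow_le' Z hi
  · omega

/-- The data of an EPIRK method with `s` stages: `a i j`, `b j`, `g i j` and the coefficients
`p i j k` of the functions `ψ_{i,j}(z) = ∑_{k=1}^{s} p i j k φ_k(z)`. All indices start at `1` and
values outside the index ranges are never used. The common simplification
`ψ_{i,j} = ψ_j = ∑_{k=1}^{j} p_{j,k} φ_k` is the special case `p i j k = p_{j,k}` for `k ≤ j` and
`p i j k = 0` for `k > j`. -/
structure Method where
  s : ℕ
  s_pos : 1 ≤ s
  a : ℕ → ℕ → ℝ
  b : ℕ → ℝ
  g : ℕ → ℕ → ℝ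
  p : ℕ → ℕ → ℕ → ℝ

namespace Method

variable {E : Type*} [NormedAddCommGroup E] [NormedSpace ℝ E]

/-- `ψ_{i,j}(Z)`. -/
def psi (m : Method) (i j : ℕ) (Z : E →L[ℝ] E) : E →L[ℝ] E :=
  ∑ k ∈ Finset.Icc 1 m.s, m.p i j k • phi k Z

/-- The remainder `r(x) = f(x) - f(y) - A (x - y)`. -/
def remainder (f : E → E) (A : E →L[ℝ] E) (y x : E) : E := f x - f y - A (x - y)

/-- The right hand side of row `i` of the method with weights `w` (that is `w j = a i j` for the
internal stage `i`, and `w = b` for the final stage `i = s`), computed from stage vectors `Y`: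
`y + w_1 ψ_{i,1}(g_{i,1} h A) h f(y) + ∑_{j=2}^{i} w_j ψ_{i,j}(g_{i,j} h A) h Δ^{(j-1)} r(Y_0)`. -/
def row (m : Method) (f : E → E) (A : E →L[ℝ] E) (y : E) (h : ℝ) (i : ℕ) (w : ℕ → ℝ)
    (Y : ℕ → E) : E :=
  y + w 1 • m.psi i 1 ((m.g i 1 * h) • A) (h • f y) +
    ∑ j ∈ Finset.Icc 2 i, w j • m.psi i j ((m.g i j * h) • A)
      (h • (fwdDiff 1)^[j - 1] (fun l => remainder f A y (Y l)) 0)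

/-- The stages computed one after the other: entry `l ≤ n` of `stagesUpTo n` is `Y_l`
(with `Y_0 = y`). -/
def stagesUpTo (m : Method) (f : E → E) (A : E →L[ℝ] E) (y : E) (h : ℝ) : ℕ → ℕ → E
  | 0 => fun _ => y
  | n + 1 => Function.update (m.stagesUpTo f A y h n) (n + 1)
      (m.row f A y h (n + 1) (m.a (n + 1)) (m.stagesUpTo f A y h n))

/-- The stage vector `Y_i`; `Y_0 = y`. -/
def stage (m : Method) (f : E → E) (A : E →L[ℝ] E) (y : E) (h : ℝ) (i : ℕ) : E :=
  m.stagesUpTo f A y h i i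

/-- One step of size `h` from `y` with the matrix `A` in place of the Jacobian. -/
def step (m : Method) (f : E → E) (A : E →L[ℝ] E) (y : E) (h : ℝ) : E :=
  m.row f A y h m.s m.b (m.stage f A y h)

theorem fwdDiff_iter_congr {G : Type*} [AddCommGroup G] (n : ℕ) :
    ∀ (u v : ℕ → G) (i : ℕ), (∀ l ≤ i + n, u l = v l) →
      (fwdDiff 1)^[n] u i = (fwdDiff 1)^[n] v i := by
  induction n with
  | zero => exact fun u v i h => h i (by omega)
  | succ n ih =>
    intro u v i h
    rw [Function.iterate_succ_apply', Function.iterate_succ_apply']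
    simp only [fwdDiff]
    rw [ih u v (i + 1) fun l hl => h l (by omega), ih u v i fun l hl => h l (by omega)]

theorem row_congr (m : Method) (f : E → E) (A : E →L[ℝ] E) (y : E) (h : ℝ) (i : ℕ) (w : ℕ → ℝ)
    (Y Z : ℕ → E) (hYZ : ∀ l < i, Y l = Z l) : m.row f A y h i w Y = m.row f A y h i w Z := by
  unfold row
  congr 1
  refine Finset.sum_congr rfl fun j hj => ?_
  rw [Finset.mem_Icc] at hj
  rw [fwdDiff_iter_congr (j - 1) _ (fun l => remainder f A y (Z l)) 0]
  intro l hl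
  simp only [hYZ l (by omega)]

theorem stagesUpTo_eq (m : Method) (f : E → E) (A : E →L[ℝ] E) (y : E) (h : ℝ) (n l : ℕ)
    (hl : l ≤ n) : m.stagesUpTo f A y h n l = m.stage f A y h l := by
  induction n with
  | zero => obtain rfl : l = 0 := by omega
            rfl
  | succ n ih =>
    rcases hl.eq_or_lt with rfl | hl
    · rfl
    · rw [stagesUpTo, Function.update_of_ne (by omega), ih (by omega)]

theorem stage_zero (m : Method) (f : E → E) (A : E →L[ℝ] E) (y : E) (h : ℝ) :
    m.stage f A y h 0 = y := rfl

/-- The stage equations of the method. -/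
theorem stage_eq (m : Method) (f : E → E) (A : E →L[ℝ] E) (y : E) (h : ℝ) (i : ℕ) (hi : 1 ≤ i) :
    m.stage f A y h i = m.row f A y h i (m.a i) (m.stage f A y h) := by
  obtain ⟨n, rfl⟩ : ∃ n, i = n + 1 := ⟨i - 1, by omega⟩
  rw [stage, stagesUpTo, Function.update_self]
  exact m.row_congr f A y h _ _ _ _ fun l hl => m.stagesUpTo_eq f A y h n l (by omega)

end Method

/-! ## The Krylov approximation of the Jacobian -/

/-- The Krylov space `span {v, J v, …, J^(M-1) v}`. -/
def krylov {E : Type*} [NormedAddCommGroup E] [NormedSpace ℝ E] (J : E →L[ℝ] E) (v : E) (M : ℕ) :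
    Submodule ℝ E :=
  Submodule.span ℝ (Set.range fun i : Fin M => (J ^ (i : ℕ)) v)

/-- The columns of the `N × M` matrix `V` are an orthonormal basis of the `M`-dimensional Krylov
space of `(J, v)`: `Vᵀ V = I_M`, and the columns span the Krylov space. -/
def IsKrylovBasis {N M : ℕ} (J : EuclideanSpace ℝ (Fin N) →L[ℝ] EuclideanSpace ℝ (Fin N))
    (v : EuclideanSpace ℝ (Fin N))
    (V : EuclideanSpace ℝ (Fin M) →L[ℝ] EuclideanSpace ℝ (Fin N)) : Prop :=
  V.adjoint ∘L V = ContinuousLinearMap.id ℝ (EuclideanSpace ℝ (Fin M)) ∧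
    V.range = krylov J v M

/-- `A = V H Vᵀ` with `H = Vᵀ J V`. -/
def krylovJacobian {N M : ℕ} (J : EuclideanSpace ℝ (Fin N) →L[ℝ] EuclideanSpace ℝ (Fin N))
    (V : EuclideanSpace ℝ (Fin M) →L[ℝ] EuclideanSpace ℝ (Fin N)) :
    EuclideanSpace ℝ (Fin N) →L[ℝ] EuclideanSpace ℝ (Fin N) :=
  V ∘L (V.adjoint ∘L J ∘L V) ∘L V.adjoint

end EPIRK

end

open EPIRK

/-! The expansion is first carried out over plane trees, where it reads `∑ c(t) h^|t| F(t)` without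
symmetry factors. Every operation in the method (linear combination, multiplication by `hA`,
application of `φ_k(γhA)`, and `u ↦ h f(y + u)`) turns such a series into another, by a rule on
coefficients that knows nothing of `f`, `A` or `N`. Induction over the stages
(`hasPlaneSeries_stagesUpTo`) then yields universal coefficients for the step. The only substantial
rule is `HasPlaneSeries.comp`: Taylor expansion of `f` with a multilinear expansion of each
derivative. Since `F` is invariant under reordering children, collecting plane trees by isomorphism
class produces the B-series over TW-trees.

In the Krylov case `V Vᵀ` is the identity on the Krylov space, so `A` and `J` agree on `J^i f` as
long as `i + 2 ≤ M`. Hence a linear tree of order `n ≤ M` has `F = J^(n-1) f` whatever its colours,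
and recolouring changes no elementary differential. Recolouring preserves order and is a retraction
of the TW-trees onto `TK(M)`, so each truncated sum can be regrouped along its fibres, which gives
the merged coefficients. -/

namespace EPIRK

namespace PlaneTW

/-! ## Recolouring -/

theorem order_recolour (k : ℕ) (t : PlaneTW) : (t.recolour k).order = t.order := by
  induction t with
  | meagre n ch ih => simp only [recolour, order, ih]
  | fat t ih =>
    simp only [recolour]
    split_ifs <;> simp [order, ih]

theorem isLinear_recolour (k : ℕ) (t : PlaneTW) : (t.recolour k).IsLinear ↔ t.IsLinear := by
  induction t with
  | meagre n ch ih => simp only [recolour, IsLinear, ih]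
  | fat t ih =>
    simp only [recolour]
    split_ifs <;> simp [IsLinear, ih]

theorem isTK_meagre {k n : ℕ} {ch : Fin n → PlaneTW} (h : ∀ i, (ch i).IsTK k) :
    (meagre n ch).IsTK k := by
  intro s hs hl ho hf
  cases hs with
  | refl => exact hf
  | meagre i hi => exact h i s hi hl ho hf

theorem IsTK.child {k n : ℕ} {ch : Fin n → PlaneTW} (h : (meagre n ch).IsTK k) (i : Fin n) :
    (ch i).IsTK k := fun s hs => h s (.meagre i hs)

theorem IsTK.of_fat {k : ℕ} {t : PlaneTW} (h : (fat t).IsTK k) : t.IsTK k :=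
  fun s hs => h s (.fat hs)

/-- A fat node survives only if its sub-tree was not both linear and of order at most `k`.
Recolouring below it changes neither property, so the surviving node is still admissible. -/
theorem isTK_recolour (k : ℕ) (t : PlaneTW) : (t.recolour k).IsTK k := by
  induction t with
  | meagre n ch ih => exact isTK_meagre ih
  | fat t ih =>
    simp only [recolour]
    split_ifs with hc
    · exact isTK_meagre fun _ => ih
    · intro s hs hl ho hf
      cases hs with
      | refl =>
        refine hc ⟨(isLinear_recolour k t).1 hl, ?_⟩
        simpa only [order, order_recolour] using ho
      | fat hi => exact ih s hi hl ho hf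

theorem IsTK.recolour_eq {k : ℕ} {t : PlaneTW} (h : t.IsTK k) : t.recolour k = t := by
  induction t with
  | meagre n ch ih =>
    simp only [recolour]
    congr 1
    exact funext fun i => ih i (h.child i)
  | fat t ih =>
    simp only [recolour]
    rw [if_neg fun hc => h _ .refl hc.1 hc.2 trivial, ih h.of_fat]

theorem order_child_lt {n : ℕ} (ch : Fin n → PlaneTW) (i : Fin n) :
    (ch i).order < (meagre n ch).order := by
  have := Finset.single_le_sum (f := fun i => (ch i).order) (fun _ _ => Nat.zero_le _)
    (Finset.mem_univ i)
  simp only [order]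
  omega

/-- Linearity and the order bound pass to all sub-trees, so the recolouring condition is met at
every fat node. -/
theorem IsLinear.allMeagre_recolour {k : ℕ} {t : PlaneTW} (hl : t.IsLinear) (ho : t.order ≤ k) :
    (t.recolour k).AllMeagre := by
  induction t with
  | meagre n ch ih =>
    exact fun i => ih i (hl.2 i) ((order_child_lt ch i).le.trans ho)
  | fat t ih =>
    simp only [recolour]
    rw [if_pos ⟨hl, ho⟩]
    refine fun _ => ih hl ?_
    simp only [order] at ho
    omega

/-! ## Elementary differentials of linear trees and Krylov spaces -/

section ElemDiff

variable {E : Type*} [NormedAddCommGroup E] [NormedSpace ℝ E]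

theorem elemDiff_meagre_one (f : E → E) (A : E →L[ℝ] E) (y : E) (ch : Fin 1 → PlaneTW) :
    (meagre 1 ch).elemDiff f A y = fderiv ℝ f y ((ch 0).elemDiff f A y) := by
  simp [elemDiff, iteratedFDeriv_one_apply]

/-- If `A` agrees with the Jacobian on the first Krylov vectors, then the elementary differentials
of small linear trees are Krylov vectors, irrespective of the colours. -/
theorem IsLinear.elemDiff_eq {f : E → E} {A : E →L[ℝ] E} {y : E} {M : ℕ}
    (hA : ∀ i, i + 2 ≤ M → A ((fderiv ℝ f y ^ i) (f y)) = (fderiv ℝ f y ^ (i + 1)) (f y))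
    {t : PlaneTW} (hl : t.IsLinear) (ho : t.order ≤ M) :
    t.elemDiff f A y = (fderiv ℝ f y ^ (t.order - 1)) (f y) := by
  induction t with
  | meagre n ch ih =>
    obtain ⟨hn, hch⟩ := hl
    interval_cases n
    · simp [elemDiff, order]
    · rw [elemDiff_meagre_one, ih 0 (hch 0) ((order_child_lt ch 0).le.trans ho),
        ← ContinuousLinearMap.comp_apply, ← ContinuousLinearMap.mul_def, ← pow_succ']
      have := (ch 0).order_pos
      congr 2
      simp only [order, Finset.univ_unique, Fin.default_eq_zero, Finset.sum_singleton]
      omega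
  | fat t ih =>
    have := t.order_pos
    simp only [order] at ho
    -- Here `i = t.order - 1`, so `i + 2 ≤ M` is exactly the order bound for `fat t`; positivity of
    -- the order makes the natural subtraction harmless.
    rw [elemDiff, ih hl (by omega), hA _ (by omega)]
    congr 2
    simp only [order]
    omega

/-- A recoloured node replaces `A` by the Jacobian, but only where the argument is a Krylov vector
on which the two agree. -/
theorem elemDiff_recolour {f : E → E} {A : E →L[ℝ] E} {y : E} {M : ℕ}
    (hA : ∀ i, i + 2 ≤ M → A ((fderiv ℝ f y ^ i) (f y)) = (fderiv ℝ f y ^ (i + 1)) (f y))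
    (t : PlaneTW) : (t.recolour M).elemDiff f A y = t.elemDiff f A y := by
  induction t with
  | meagre n ch ih => simp only [recolour, elemDiff, ih]
  | fat t ih =>
    simp only [recolour]
    split_ifs with hc
    · have := t.order_pos
      have ho := hc.2
      simp only [order] at ho
      rw [elemDiff_meagre_one, ih, elemDiff, IsLinear.elemDiff_eq (t := t) hA hc.1 (by omega),
        hA _ (by omega), pow_succ']
      rfl
    · simp only [elemDiff, ih]

end ElemDiff

/-! ### Finiteness of symmetry groups and of sets of trees of bounded order -/

theorem finite_isos (s : PlaneTW) : ∀ t, Finite (Isos s t) := by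
  induction s with
  | meagre n ch ih =>
    rintro (⟨n', ch'⟩ | t)
    · have := ih
      exact inferInstanceAs (Finite (Σ e : Fin n ≃ Fin n', ∀ i, Isos (ch i) (ch' (e i))))
    · exact inferInstanceAs (Finite Empty)
  | fat s ih =>
    rintro (⟨n', ch'⟩ | t)
    · exact inferInstanceAs (Finite Empty)
    · exact ih t

/-- `symm` is a `Nat.card`, which is zero for infinite types. Positivity allows `σ` to be cancelled
when coefficients are regrouped. -/
theorem symm_pos (t : PlaneTW) : 0 < t.symm := by
  have := finite_isos t t
  have : Nonempty (Isos t t) := Iso.refl t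
  exact Nat.card_pos

/-- The finite set of plane trees of order at most `n`. -/
noncomputable def orderLE (n : ℕ) : Finset PlaneTW := (finite_order_le n).toFinset

theorem mem_orderLE {n : ℕ} {t : PlaneTW} : t ∈ orderLE n ↔ t.order ≤ n := by
  simp [orderLE]

end PlaneTW

/-! ### Passage to isomorphism classes -/

namespace TW

theorem mem_orderLE {n : ℕ} {τ : TW} : τ ∈ orderLE n ↔ τ.order ≤ n := by
  simp [orderLE]

theorem order_mk (t : PlaneTW) : order ⟦t⟧ = t.order := rfl

theorem symm_pos (τ : TW) : 0 < τ.symm := by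
  induction τ using Quotient.inductionOn with
  | h t => exact t.symm_pos

theorem order_recolour (k : ℕ) (τ : TW) : (τ.recolour k).order = τ.order := by
  induction τ using Quotient.inductionOn with
  | h t => exact t.order_recolour k

theorem recolour_mem_TK (k : ℕ) (τ : TW) : τ.recolour k ∈ TK k := by
  induction τ using Quotient.inductionOn with
  | h t => exact t.isTK_recolour k

theorem mem_TK_iff (k : ℕ) (τ : TW) : τ ∈ TK k ↔ τ.recolour k = τ := by
  refine ⟨?_, fun h => h ▸ recolour_mem_TK k τ⟩
  induction τ using Quotient.inductionOn with
  | h t => exact fun h => congrArg (Quotient.mk _) (PlaneTW.IsTK.recolour_eq h)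

theorem IsLinear.allMeagre_recolour {k : ℕ} {τ : TW} (hl : τ.IsLinear) (ho : τ.order ≤ k) :
    (τ.recolour k).AllMeagre := by
  induction τ using Quotient.inductionOn with
  | h t => exact PlaneTW.IsLinear.allMeagre_recolour hl ho

section ElemDiff

variable {E : Type*} [NormedAddCommGroup E] [NormedSpace ℝ E]

/-- `TW.elemDiff` uses an unspecified representative; symmetry of the higher derivatives allows any
other to be used instead. -/
theorem elemDiff_mk {f : E → E} {y : E} (hf : ContDiffAt ℝ ∞ f y) (A : E →L[ℝ] E)
    (t : PlaneTW) : elemDiff f A y ⟦t⟧ = t.elemDiff f A y :=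
  PlaneTW.Iso.elemDiff_eq hf A (Quotient.mk_out (s := PlaneTW.setoid) t)

theorem elemDiff_recolour {f : E → E} {A : E →L[ℝ] E} {y : E} (hf : ContDiffAt ℝ ∞ f y) {M : ℕ}
    (hA : ∀ i, i + 2 ≤ M → A ((fderiv ℝ f y ^ i) (f y)) = (fderiv ℝ f y ^ (i + 1)) (f y))
    (τ : TW) : (τ.recolour M).elemDiff f A y = τ.elemDiff f A y := by
  induction τ using Quotient.inductionOn with
  | h t =>
    rw [elemDiff_mk hf]
    exact (elemDiff_mk hf A _).trans (PlaneTW.elemDiff_recolour hA t)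

end ElemDiff

end TW

/-! ### Agreement of the Krylov approximation with the Jacobian -/

theorem krylovJacobian_apply_pow {N M : ℕ}
    {J : EuclideanSpace ℝ (Fin N) →L[ℝ] EuclideanSpace ℝ (Fin N)} {v : EuclideanSpace ℝ (Fin N)}
    {V : EuclideanSpace ℝ (Fin M) →L[ℝ] EuclideanSpace ℝ (Fin N)} (hV : IsKrylovBasis J v V)
    (i : ℕ) (hi : i + 2 ≤ M) : krylovJacobian J V ((J ^ i) v) = (J ^ (i + 1)) v := by
  -- `V Vᵀ` fixes the range of `V`, because `Vᵀ V = I`. It is used for both `J^i v` and `J^(i+1) v`,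
  -- whence the bound `i + 2 ≤ M`.
  have hfix : ∀ l < M, V (V.adjoint ((J ^ l) v)) = (J ^ l) v := by
    intro l hl
    have hmem : (J ^ l) v ∈ V.range := by
      rw [hV.2]
      exact Submodule.subset_span ⟨⟨l, hl⟩, rfl⟩
    obtain ⟨x, hx⟩ := hmem
    have hx' : V x = (J ^ l) v := hx
    rw [← hx', ← ContinuousLinearMap.comp_apply V.adjoint, hV.1]
    rfl
  simp only [krylovJacobian, ContinuousLinearMap.comp_apply]
  rw [hfix i (by omega), ← ContinuousLinearMap.comp_apply J, ← ContinuousLinearMap.mul_def,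
    ← pow_succ', hfix (i + 1) (by omega)]

/-! ### Regrouping the B-series along the fibres of recolouring -/

section Merge

variable {E : Type*} [NormedAddCommGroup E] [NormedSpace ℝ E]

theorem truncBSeries_univ (a : Option TW → ℝ) (f : E → E) (A : E →L[ℝ] E) (y : E) (p : ℕ)
    (h : ℝ) : truncBSeries Set.univ a f A y p h = a none • y + ∑ τ ∈ TW.orderLE p,
      (a (some τ) * h ^ τ.order / (τ.symm : ℝ)) • τ.elemDiff f A y := by
  simp only [truncBSeries, Set.mem_univ, Finset.filter_true]

open Classical in
theorem truncBSeries_mergedCoeff {f : E → E} {A : E →L[ℝ] E} {y : E} {M : ℕ}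
    (hF : ∀ τ : TW, (τ.recolour M).elemDiff f A y = τ.elemDiff f A y)
    (a : Option TW → ℝ) (p : ℕ) (h : ℝ) :
    truncBSeries (TW.TK M) (mergedCoeff M a) f A y p h = truncBSeries Set.univ a f A y p h := by
  rw [truncBSeries_univ, truncBSeries]
  congr 1
  rw [← Finset.sum_fiberwise_of_maps_to (s := TW.orderLE p)
    (t := (TW.orderLE p).filter (· ∈ TW.TK M)) (g := TW.recolour M)]
  · refine Finset.sum_congr rfl fun τ hτ => ?_
    have hs : (τ.symm : ℝ) ≠ 0 := by exact_mod_cast τ.symm_pos.ne'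
    have hτp : τ.order ≤ p := TW.mem_orderLE.1 (Finset.mem_filter.1 hτ).1
    have : mergedCoeff M a (some τ) * h ^ τ.order / (τ.symm : ℝ) =
        ∑ θ ∈ (TW.orderLE τ.order).filter (fun θ => θ.recolour M = τ),
          a (some θ) * h ^ θ.order / θ.symm := by
      have hm : mergedCoeff M a (some τ) = τ.symm *
        ∑ θ ∈ (TW.orderLE τ.order).filter (fun θ => θ.recolour M = τ),
          a (some θ) / θ.symm := rfl
      rw [hm, mul_assoc, mul_div_cancel_left₀ _ hs, Finset.sum_mul]
      refine Finset.sum_congr rfl fun θ hθ => ?_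
      rw [← (Finset.mem_filter.1 hθ).2, TW.order_recolour]
      ring
    rw [this, Finset.sum_smul]
    -- Recolouring preserves order, so the fibre over `τ` is the same whether cut off at `|τ|` or at
    -- `p`.
    refine Finset.sum_congr ?_ fun θ hθ => ?_
    · ext θ
      simp only [Finset.mem_filter, TW.mem_orderLE]
      refine and_congr_left fun hθ => ?_
      have : θ.order = τ.order := by rw [← hθ, TW.order_recolour]
      omega
    · rw [← hF θ, (Finset.mem_filter.1 hθ).2]
  · intro τ hτ
    simp only [Finset.mem_filter, TW.mem_orderLE, TW.order_recolour] at hτ ⊢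
    exact ⟨hτ, TW.recolour_mem_TK M τ⟩

end Merge

/-! ## Taylor expansion -/

/-- The integral remainder along the segment from `y` to `y + x` is controlled by a local bound on
the derivative of order `p + 1`. -/
theorem taylor_isBigO {E F : Type*} [NormedAddCommGroup E] [NormedSpace ℝ E]
    [NormedAddCommGroup F] [NormedSpace ℝ F] [CompleteSpace F] {f : E → F} {y : E}
    (hf : ContDiffAt ℝ ∞ f y) (p : ℕ) :
    (fun x : E => f (y + x) - ∑ n ∈ Finset.range (p + 1),
      (n.factorial : ℝ)⁻¹ • iteratedFDeriv ℝ n f y fun _ => x) =O[𝓝 0]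
        fun x => ‖x‖ ^ (p + 1) := by
  -- Differentiability of a finite order at `y` persists on a ball, as the Taylor formula along
  -- segments requires.
  have hp : ContDiffAt ℝ (p + 1 : ℕ) f y := hf.of_le (by exact_mod_cast le_top)
  have hb : ∀ᶠ z in 𝓝 y, ‖iteratedFDeriv ℝ (p + 1) f z‖ ≤ ‖iteratedFDeriv ℝ (p + 1) f y‖ + 1 :=
    ((hp.continuousAt_iteratedFDeriv le_rfl).norm.eventually_lt continuousAt_const
      (lt_add_one _)).mono fun _ h => h.le
  obtain ⟨ε, hε, hball⟩ := Metric.eventually_nhds_iff_ball.1 (hb.and (hp.eventually (by simp)))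
  refine IsBigO.of_bound ((p.factorial : ℝ)⁻¹ * (‖iteratedFDeriv ℝ (p + 1) f y‖ + 1)) ?_
  filter_upwards [Metric.ball_mem_nhds (0 : E) hε] with x hx
  have hseg : ∀ t ∈ Set.Icc (0 : ℝ) 1, y + t • x ∈ Metric.ball y ε := by
    intro t ht
    rw [mem_ball_zero_iff] at hx
    rw [mem_ball_iff_norm, add_sub_cancel_left, norm_smul, Real.norm_of_nonneg ht.1]
    exact (mul_le_of_le_one_left (norm_nonneg x) ht.2).trans_lt hx
  rw [map_add_eq_sum_add_integral_iteratedFDeriv (f := f) (x := y) (y := x) (n := p)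
    fun t ht => by exact_mod_cast (hball _ (hseg t ht)).2, add_sub_cancel_left, norm_smul,
    norm_inv, Real.norm_natCast, Real.norm_of_nonneg (by positivity), mul_assoc]
  gcongr
  refine (intervalIntegral.norm_integral_le_of_norm_le_const
    (C := (‖iteratedFDeriv ℝ (p + 1) f y‖ + 1) * ‖x‖ ^ (p + 1)) fun t ht => ?_).trans (by simp)
  rw [Set.uIoc_of_le zero_le_one] at ht
  have h1 : ‖(1 - t) ^ p‖ ≤ 1 := by
    rw [norm_pow, Real.norm_of_nonneg (by linarith [ht.2])]
    exact pow_le_one₀ (by linarith [ht.2]) (by linarith [ht.1])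
  rw [norm_smul]
  refine (mul_le_of_le_one_left (norm_nonneg _) h1).trans ?_
  refine ((iteratedFDeriv ℝ (p + 1) f (y + t • x)).le_opNorm _).trans ?_
  rw [Finset.prod_const, Finset.card_univ, Fintype.card_fin]
  gcongr
  exact (hball _ (hseg t ⟨ht.1.le, ht.2⟩)).1

theorem isBigO_pow_of_le {m n : ℕ} (h : m ≤ n) :
    (fun x : ℝ => x ^ n) =O[𝓝 0] fun x => x ^ m := by
  refine IsBigO.of_bound 1 ?_
  filter_upwards [Metric.closedBall_mem_nhds (0 : ℝ) one_pos] with x hx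
  rw [mem_closedBall_zero_iff] at hx
  rw [one_mul, norm_pow, norm_pow]
  exact pow_le_pow_of_le_one (norm_nonneg x) hx h

/-- The diagonal of a multilinear map is locally Lipschitz. -/
theorem isBigO_multilinear_sub {E F : Type*} [NormedAddCommGroup E] [NormedSpace ℝ E]
    [NormedAddCommGroup F] [NormedSpace ℝ F] {n : ℕ} (D : ContinuousMultilinearMap ℝ
      (fun _ : Fin n => E) F) {u v : ℝ → E} (hu : Tendsto u (𝓝 0) (𝓝 0))
    (hv : Tendsto v (𝓝 0) (𝓝 0)) :
    (fun h => D (fun _ => u h) - D fun _ => v h) =O[𝓝 0] fun h => u h - v h := by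
  refine IsBigO.of_bound (‖D‖ * n) ?_
  have hb : ∀ {w : ℝ → E}, Tendsto w (𝓝 0) (𝓝 0) → ∀ᶠ h in 𝓝 0, ‖w h‖ ≤ 1 := fun hw =>
    (hw.norm.eventually_lt_const (by simp)).mono fun _ h => h.le
  filter_upwards [hb hu, hb hv] with h h1 h2
  refine (D.norm_image_sub_le _ _).trans ?_
  rw [Fintype.card_fin]
  have hm : max ‖fun _ : Fin n => u h‖ ‖fun _ : Fin n => v h‖ ^ (n - 1) ≤ 1 :=
    pow_le_one₀ (by positivity) (max_le ((pi_norm_const_le _).trans h1)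
      ((pi_norm_const_le _).trans h2))
  have hd : ‖(fun _ : Fin n => u h) - fun _ => v h‖ ≤ ‖u h - v h‖ := pi_norm_const_le (u h - v h)
  calc _ ≤ ‖D‖ * n * 1 * ‖u h - v h‖ := by gcongr
    _ = _ := by ring

theorem phi_sub_isBigO {E : Type*} [NormedAddCommGroup E] [NormedSpace ℝ E] [CompleteSpace E]
    (k p : ℕ) (A : E →L[ℝ] E) :
    (fun h : ℝ => phi k (h • A) - ∑ i ∈ Finset.range (p + 1),
      ((i + k).factorial : ℝ)⁻¹ • (h • A) ^ i) =O[𝓝 0] fun h => h ^ (p + 1) := by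
  -- After `‖Z‖^(p+1)` is factored out, the tail is dominated by the exponential series, since `(i +
  -- p + 1 + k)! ≥ i!`.
  have hbound : ∀ Z : E →L[ℝ] E, ‖phi k Z - ∑ i ∈ Finset.range (p + 1),
      ((i + k).factorial : ℝ)⁻¹ • Z ^ i‖ ≤ ‖Z‖ ^ (p + 1) * Real.exp ‖Z‖ := by
    intro Z
    have hs := summable_phi k Z
    rw [phi, ← hs.sum_add_tsum_nat_add (p + 1), add_sub_cancel_left]
    refine tsum_of_norm_bounded (g := fun i => ‖Z‖ ^ (p + 1) * (‖Z‖ ^ i / i.factorial)) ?_ ?_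
    · rw [Real.exp_eq_exp_ℝ]
      exact (NormedSpace.expSeries_div_hasSum_exp ‖Z‖).mul_left _
    · intro i
      rw [norm_smul, norm_inv, Real.norm_natCast]
      calc _ ≤ (i.factorial : ℝ)⁻¹ * ‖Z‖ ^ (i + (p + 1)) := by
            gcongr
            · omega
            · exact norm_pow_le' Z (by omega)
        _ = _ := by rw [pow_add]; ring
  refine (IsBigO.of_bound 1 (Eventually.of_forall fun h => ?_)).trans
    (g := fun h : ℝ => h ^ (p + 1) * (‖A‖ ^ (p + 1) * Real.exp (‖h‖ * ‖A‖))) ?_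
  · refine (hbound _).trans (le_of_eq ?_)
    rw [norm_smul, one_mul, norm_mul, norm_mul, norm_pow, norm_pow, norm_norm,
      Real.norm_of_nonneg (Real.exp_nonneg _)]
    ring
  · have hc : Continuous fun h : ℝ => ‖A‖ ^ (p + 1) * Real.exp (‖h‖ * ‖A‖) := by fun_prop
    simpa using (isBigO_refl (fun h : ℝ => h ^ (p + 1)) (𝓝 0)).mul
      ((hc.tendsto 0).isBigO_one ℝ)

/-! ## Series over plane trees -/

/-- Coefficients of `h A u` in terms of those of `u`. -/
def fatCoeff (c : PlaneTW → ℝ) : PlaneTW → ℝ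
  | .meagre _ _ => 0
  | .fat t => c t

/-- Coefficients of `h f(y + u)` in terms of those of `u`. -/
noncomputable def compCoeff (c : PlaneTW → ℝ) : PlaneTW → ℝ
  | .meagre n ch => (n.factorial : ℝ)⁻¹ * ∏ i, c (ch i)
  | .fat _ => 0

/-- Coefficients of `φ_k(γ h A) u` in terms of those of `u`. -/
noncomputable def phiCoeff (k : ℕ) (γ : ℝ) (c : PlaneTW → ℝ) (t : PlaneTW) : ℝ :=
  ∑ l ∈ Finset.range t.order, (((l + k).factorial : ℝ)⁻¹ * γ ^ l) * fatCoeff^[l] c t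

/-- Each application strips a fat root, and a tree with at most `l` nodes cannot lose `l` of them
and leave a tree. Hence the finite sum in `phiCoeff` omits only zeros. -/
theorem fatCoeff_iterate_eq_zero (c : PlaneTW → ℝ) (l : ℕ) (t : PlaneTW) (h : t.order ≤ l) :
    fatCoeff^[l] c t = 0 := by
  induction l generalizing t with
  | zero => exact absurd t.order_pos (by omega)
  | succ l ih =>
    rw [Function.iterate_succ_apply']
    cases t with
    | meagre n ch => rfl
    | fat t =>
      simp only [PlaneTW.order] at h
      exact ih t (by omega)

/-- Splitting a sum over trees at the root. -/
theorem PlaneTW.sum_orderLE_succ {G : Type*} [AddCommMonoid G] (g : PlaneTW → G) (p : ℕ) :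
    ∑ t ∈ orderLE (p + 1), g t =
      (∑ n ∈ Finset.range (p + 1), ∑ ch ∈ (Fintype.piFinset fun _ : Fin n => orderLE p).filter
        (fun ch => ∑ i, (ch i).order ≤ p), g (meagre n ch)) + ∑ t ∈ orderLE p, g (fat t) := by
  classical
  rw [Finset.sum_sigma', ← Finset.sum_filter_add_sum_filter_not _ FatRoot, add_comm]
  congr 1
  · symm
    refine Finset.sum_bij (fun x _ => meagre x.1 x.2) ?_ ?_ ?_ fun _ _ => rfl
    · rintro ⟨n, ch⟩ h
      simp only [Finset.mem_sigma, Finset.mem_filter] at h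
      refine Finset.mem_filter.2 ⟨mem_orderLE.2 ?_, not_false⟩
      simp only [order]
      omega
    · rintro ⟨n, ch⟩ - ⟨n', ch'⟩ - h
      simp only [meagre.injEq] at h
      exact Sigma.ext h.1 h.2
    · rintro (⟨n, ch⟩ | t) ht
      · simp only [Finset.mem_filter, mem_orderLE, order] at ht
        -- Each child has at least one node, so at most `p` children fit: this bounds the outer
        -- range.
        have hn : n ≤ ∑ i, (ch i).order := by
          simpa using Finset.sum_le_sum (s := Finset.univ) (f := fun _ => 1)
            (g := fun i => (ch i).order) fun (i : Fin n) _ => order_pos (ch i)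
        refine ⟨⟨n, ch⟩, ?_, rfl⟩
        simp only [Finset.mem_sigma, Finset.mem_filter, Finset.mem_range, Fintype.mem_piFinset,
          mem_orderLE]
        refine ⟨by omega, fun i => ?_, by omega⟩
        have := order_child_lt ch i
        simp only [order] at this
        omega
      · exact absurd trivial (Finset.mem_filter.1 ht).2
  · symm
    refine Finset.sum_bij (fun t _ => fat t) ?_ ?_ ?_ fun _ _ => rfl
    · intro t ht
      rw [mem_orderLE] at ht
      refine Finset.mem_filter.2 ⟨mem_orderLE.2 ?_, trivial⟩
      simp only [order]
      omega
    · intro t _ t' _ h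
      exact fat.inj h
    · rintro (⟨n, ch⟩ | t) ht
      · exact (Finset.mem_filter.1 ht).2.elim
      · simp only [Finset.mem_filter, mem_orderLE, order] at ht
        exact ⟨t, mem_orderLE.2 (by omega), rfl⟩

section Series

variable {E : Type*} [NormedAddCommGroup E] [NormedSpace ℝ E]

/-- The series `∑ c(t) h^|t| F(t)(y)` over the plane trees of order at most `p`. -/
noncomputable def planeSum (c : PlaneTW → ℝ) (f : E → E) (A : E →L[ℝ] E) (y : E) (p : ℕ) (h : ℝ) :
    E :=
  ∑ t ∈ PlaneTW.orderLE p, (c t * h ^ t.order) • t.elemDiff f A y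

/-- `u` has the series `∑ c(t) h^|t| F(t)(y)` over all plane trees as its expansion at `0`. -/
def HasPlaneSeries (c : PlaneTW → ℝ) (f : E → E) (A : E →L[ℝ] E) (y : E) (u : ℝ → E) : Prop :=
  ∀ p : ℕ, (fun h => u h - planeSum c f A y p h) =O[𝓝 0] fun h => h ^ (p + 1)

theorem planeSum_zero_right (c : PlaneTW → ℝ) (f : E → E) (A : E →L[ℝ] E) (y : E) (h : ℝ) :
    planeSum c f A y 0 h = 0 := by
  have : PlaneTW.orderLE 0 = ∅ := by
    ext t
    simpa [PlaneTW.mem_orderLE] using t.order_pos.ne'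
  rw [planeSum, this, Finset.sum_empty]

theorem planeSum_isBigO (c : PlaneTW → ℝ) (f : E → E) (A : E →L[ℝ] E) (y : E) (p : ℕ) :
    planeSum c f A y p =O[𝓝 0] fun h : ℝ => h := by
  refine IsBigO.fun_sum fun t _ => ?_
  have h1 : (fun h : ℝ => h ^ t.order) =O[𝓝 0] fun h : ℝ => h := by
    simpa using isBigO_pow_of_le t.order_pos
  have := (h1.const_mul_left (c t)).smul (isBigO_refl (fun _ : ℝ => t.elemDiff f A y) (𝓝 0))
  refine this.trans ?_
  simpa using (isBigO_refl (fun h : ℝ => h) (𝓝 0)).smul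
    (isBigO_const_const (t.elemDiff f A y) (one_ne_zero (α := ℝ)) (𝓝 0))

namespace HasPlaneSeries

variable {f : E → E} {A : E →L[ℝ] E} {y : E} {c d : PlaneTW → ℝ} {u v : ℝ → E}

/-- No tree has order zero, so the case `p = 0` has an empty sum. -/
theorem isBigO (hu : HasPlaneSeries c f A y u) : u =O[𝓝 0] fun h : ℝ => h := by
  simpa [planeSum_zero_right] using hu 0

theorem tendsto (hu : HasPlaneSeries c f A y u) : Tendsto u (𝓝 0) (𝓝 0) :=
  hu.isBigO.trans_tendsto tendsto_id

theorem zero : HasPlaneSeries 0 f A y fun _ => 0 := fun p => by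
  simpa [planeSum] using isBigO_zero _ _

theorem add (hu : HasPlaneSeries c f A y u) (hv : HasPlaneSeries d f A y v) :
    HasPlaneSeries (c + d) f A y fun h => u h + v h := fun p => by
  refine ((hu p).add (hv p)).congr_left fun h => ?_
  simp only [planeSum, Pi.add_apply, add_mul, add_smul, Finset.sum_add_distrib]
  abel

theorem const_smul (hu : HasPlaneSeries c f A y u) (r : ℝ) :
    HasPlaneSeries (r • c) f A y fun h => r • u h := fun p => by
  refine ((hu p).const_smul_left r).congr_left fun h => ?_
  simp only [planeSum, Pi.smul_apply, smul_eq_mul, smul_sub, Finset.smul_sum, smul_smul, mul_assoc]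

theorem sub (hu : HasPlaneSeries c f A y u) (hv : HasPlaneSeries d f A y v) :
    HasPlaneSeries (c - d) f A y fun h => u h - v h := by
  have := hu.add (hv.const_smul (-1))
  simpa only [neg_one_smul, ← sub_eq_add_neg] using this

theorem sum {ι : Type*} (s : Finset ι) {c : ι → PlaneTW → ℝ} {u : ι → ℝ → E}
    (hu : ∀ i ∈ s, HasPlaneSeries (c i) f A y (u i)) :
    HasPlaneSeries (∑ i ∈ s, c i) f A y fun h => ∑ i ∈ s, u i h := by
  classical
  induction s using Finset.induction_on with
  | empty => simpa using zero
  | insert i s hi ih =>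
    simp only [Finset.sum_insert hi]
    exact (hu i (by simp)).add (ih fun j hj => hu j (by simp [hj]))

theorem fwdDiff_iterate {c : ℕ → PlaneTW → ℝ} {u : ℕ → ℝ → E}
    (hu : ∀ l, HasPlaneSeries (c l) f A y (u l)) (n : ℕ) : ∀ i,
    HasPlaneSeries ((fwdDiff 1)^[n] c i) f A y fun h => (fwdDiff 1)^[n] (fun l => u l h) i := by
  induction n with
  | zero => exact hu
  | succ n ih =>
    intro i
    simp only [Function.iterate_succ_apply', fwdDiff]
    exact (ih (i + 1)).sub (ih i)

theorem fat (hu : HasPlaneSeries c f A y u) :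
    HasPlaneSeries (fatCoeff c) f A y fun h => (h • A) (u h) := by
  have hA : ∀ w : ℝ → E, (fun h => A (w h)) =O[𝓝 0] w := fun w => A.isBigO_comp w _
  -- The factor `h` gains one order: accuracy `p + 1` needs only accuracy `p` of `u`, and accuracy
  -- `0` only boundedness.
  rintro (_ | p)
  · simpa [planeSum_zero_right] using
      (isBigO_refl (fun h : ℝ => h) (𝓝 0)).smul
        ((hA u).trans (hu.tendsto.isBigO_one ℝ))
  · refine ((isBigO_refl (fun h : ℝ => h) (𝓝 0)).smul ((hA _).trans (hu p))).congr
      (fun h => ?_) fun h => ?_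
    · rw [planeSum.eq_1 (fatCoeff c), PlaneTW.sum_orderLE_succ]
      simp only [fatCoeff, zero_mul, zero_smul, Finset.sum_const_zero, zero_add, planeSum, map_sub,
        map_sum, map_smul, smul_sub, Finset.smul_sum, smul_smul, PlaneTW.order, PlaneTW.elemDiff,
        FunLike.coe_smul, Pi.smul_apply]
      congr 1
      refine Finset.sum_congr rfl fun t _ => ?_
      congr 1
      ring
    · rw [smul_eq_mul, ← pow_succ']

theorem fat_iterate (hu : HasPlaneSeries c f A y u) (l : ℕ) :
    HasPlaneSeries (fatCoeff^[l] c) f A y fun h => ((h • A) ^ l) (u h) := by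
  induction l with
  | zero => simpa using hu
  | succ l ih =>
    simp only [Function.iterate_succ_apply', pow_succ']
    exact ih.fat

/-- `φ_k` is replaced by its Taylor polynomial of degree `p`, whose terms are covered by
`fat_iterate`; the error operator is `O(h^(p+1))` and acts on a bounded `u`. -/
theorem phi [CompleteSpace E] (hu : HasPlaneSeries c f A y u) (k : ℕ) (γ : ℝ) :
    HasPlaneSeries (phiCoeff k γ c) f A y fun h => EPIRK.phi k ((γ * h) • A) (u h) := by
  intro p
  have h1 := (sum (Finset.range (p + 1)) fun l _ =>
    (hu.fat_iterate l).const_smul (((l + k).factorial : ℝ)⁻¹ * γ ^ l)) p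
  have ht : Tendsto (fun h : ℝ => γ * h) (𝓝 0) (𝓝 0) := by
    simpa using (continuous_const_mul γ).tendsto (0 : ℝ)
  have h2 := (phi_sub_isBigO k p A).comp_tendsto ht
  have h3 : (fun h : ℝ => (γ * h) ^ (p + 1)) =O[𝓝 0] fun h => h ^ (p + 1) :=
    ((isBigO_refl (fun h : ℝ => h) (𝓝 0)).const_mul_left γ).pow _
  have hu1 : u =O[𝓝 0] fun _ => (1 : ℝ) := hu.tendsto.isBigO_one ℝ
  have h4 : (fun h : ℝ => (EPIRK.phi k ((γ * h) • A) - ∑ i ∈ Finset.range (p + 1),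
      ((i + k).factorial : ℝ)⁻¹ • ((γ * h) • A) ^ i) (u h)) =O[𝓝 0] fun h => h ^ (p + 1) := by
    refine IsBigO.trans (IsBigO.of_bound 1 (Eventually.of_forall fun h => ?_))
      ((((h2.trans h3).norm_left.mul hu1.norm_left)).congr_right fun h => mul_one _)
    rw [one_mul, norm_mul, norm_norm, norm_norm]
    exact ContinuousLinearMap.le_opNorm _ _
  refine (h4.add h1).congr_left fun h => ?_
  -- The powers with `t.order ≤ l ≤ p` contribute nothing to the coefficient of `t`.
  have hs : planeSum (phiCoeff k γ c) f A y p h = planeSum (∑ l ∈ Finset.range (p + 1),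
      (((l + k).factorial : ℝ)⁻¹ * γ ^ l) • fatCoeff^[l] c) f A y p h := by
    refine Finset.sum_congr rfl fun t ht => ?_
    rw [PlaneTW.mem_orderLE] at ht
    congr 2
    rw [phiCoeff, Finset.sum_apply]
    refine Finset.sum_subset (Finset.range_mono (by omega)) fun l _ hl => ?_
    rw [fatCoeff_iterate_eq_zero _ _ _ (by simpa using hl), mul_zero]
  have hm : ∀ l, ((γ * h) • A) ^ l = γ ^ l • (h • A) ^ l := fun l => by
    rw [mul_smul, smul_pow]
  rw [hs]
  simp only [sub_apply, FunLike.coe_sum, Finset.sum_apply,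
    FunLike.coe_smul, Pi.smul_apply, hm, smul_smul]
  abel

/-- Expanding the `n`-th Taylor term multilinearly gives ordered `n`-tuples of trees, that is, plane
trees with a meagre root and `n` children; the outer `h` counts the root. Three errors arise:
truncating Taylor's formula (`h1`), replacing `u` by its truncated series `U` (`h2`), and discarding
tuples of total order above `p` (`h3`). -/
theorem comp [CompleteSpace E] (hf : ContDiffAt ℝ ∞ f y) (hu : HasPlaneSeries c f A y u) :
    HasPlaneSeries (compCoeff c) f A y fun h => h • f (y + u h) := by
  rintro (_ | p)
  · have h1 : Tendsto (fun h => f (y + u h)) (𝓝 0) (𝓝 (f y)) := by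
      have : Tendsto (fun h => y + u h) (𝓝 0) (𝓝 y) := by
        simpa using tendsto_const_nhds.add hu.tendsto
      exact hf.continuousAt.tendsto.comp this
    simpa [planeSum_zero_right] using
      (isBigO_refl (fun h : ℝ => h) (𝓝 0)).smul (h1.isBigO_one ℝ)
  · set U := planeSum c f A y p with hU
    have hUt : Tendsto U (𝓝 0) (𝓝 0) := (planeSum_isBigO c f A y p).trans_tendsto tendsto_id
    set D := fun n => iteratedFDeriv ℝ n f y with hD
    have h1 : (fun h => f (y + u h) - ∑ n ∈ Finset.range (p + 1),
        (n.factorial : ℝ)⁻¹ • D n fun _ => u h) =O[𝓝 0] fun h : ℝ => h ^ (p + 1) :=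
      ((taylor_isBigO hf p).comp_tendsto hu.tendsto).trans (hu.isBigO.norm_left.pow _)
    have h2 : (fun h => ∑ n ∈ Finset.range (p + 1), (n.factorial : ℝ)⁻¹ •
        ((D n fun _ => u h) - D n fun _ => U h)) =O[𝓝 0] fun h : ℝ => h ^ (p + 1) :=
      IsBigO.fun_sum fun n _ => ((isBigO_multilinear_sub (D n) hu.tendsto hUt).trans
        (hu p)).const_smul_left _
    set g : ℝ → (n : ℕ) → (Fin n → PlaneTW) → E := fun h n ch =>
      (∏ i, (c (ch i) * h ^ (ch i).order)) • D n fun i => (ch i).elemDiff f A y with hg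
    have hprod : ∀ h n ch, g h n ch =
        ((∏ i, c (ch i)) * h ^ ∑ i, (ch i).order) • D n fun i => (ch i).elemDiff f A y := by
      intro h n ch
      rw [hg]
      simp only [Finset.prod_mul_distrib, Finset.prod_pow_eq_pow_sum]
    have h3 : (fun h => ∑ n ∈ Finset.range (p + 1), (n.factorial : ℝ)⁻¹ •
        ∑ ch ∈ (Fintype.piFinset fun _ : Fin n => PlaneTW.orderLE p).filter
          (fun ch => ¬ ∑ i, (ch i).order ≤ p), g h n ch) =O[𝓝 0] fun h : ℝ => h ^ (p + 1) := by
      refine IsBigO.fun_sum fun n _ => IsBigO.const_smul_left (IsBigO.fun_sum fun ch hch => ?_) _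
      simp only [hprod, mul_smul]
      have hle : p + 1 ≤ ∑ i, (ch i).order := by
        have := (Finset.mem_filter.1 hch).2
        omega
      refine IsBigO.const_smul_left ?_ _
      simpa using (isBigO_pow_of_le hle).smul
        (isBigO_const_const (D n fun i => (ch i).elemDiff f A y) (one_ne_zero (α := ℝ)) (𝓝 0))
    have hexp : ∀ h n, (D n fun _ => U h) =
        ∑ ch ∈ Fintype.piFinset fun _ : Fin n => PlaneTW.orderLE p, g h n ch := by
      intro h n
      simp only [hU, planeSum]
      rw [(D n).map_sum_finset (fun (_ : Fin n) (t : PlaneTW) =>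
        (c t * h ^ t.order) • t.elemDiff f A y) fun _ => PlaneTW.orderLE p]
      exact Finset.sum_congr rfl fun ch _ => (D n).map_smul_univ _ _
    have h4 := (isBigO_refl (fun h : ℝ => h) (𝓝 0)).smul ((h1.add h2).add h3)
    refine h4.congr (fun h => ?_) fun h => by rw [smul_eq_mul, ← pow_succ']
    have hsplit : planeSum (compCoeff c) f A y (p + 1) h =
        h • ∑ n ∈ Finset.range (p + 1), (n.factorial : ℝ)⁻¹ •
          ∑ ch ∈ (Fintype.piFinset fun _ : Fin n => PlaneTW.orderLE p).filter
            (fun ch => ∑ i, (ch i).order ≤ p), g h n ch := by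
      rw [planeSum, PlaneTW.sum_orderLE_succ]
      simp only [compCoeff, zero_mul, zero_smul, Finset.sum_const_zero, add_zero,
        Finset.smul_sum, hprod, smul_smul, PlaneTW.order, PlaneTW.elemDiff]
      refine Finset.sum_congr rfl fun n _ => Finset.sum_congr rfl fun ch _ => ?_
      congr 1
      ring
    rw [hsplit, ← smul_sub]
    congr 1
    simp only [smul_sub, Finset.sum_sub_distrib, hexp]
    simp only [← Finset.sum_filter_add_sum_filter_not (Fintype.piFinset _)
      (fun ch : Fin _ → PlaneTW => ∑ i, (ch i).order ≤ p), smul_add, Finset.sum_add_distrib]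
    abel

end HasPlaneSeries

end Series

/-! ## The series of the numerical solution -/

namespace Method

/-- Coefficients of `ψ_{i,j}(γ h A) u` in terms of those of `u`. -/
noncomputable def psiCoeff (m : Method) (i j : ℕ) (γ : ℝ) (c : PlaneTW → ℝ) : PlaneTW → ℝ :=
  ∑ k ∈ Finset.Icc 1 m.s, m.p i j k • phiCoeff k γ c

/-- Coefficients of `h r(y + u)` in terms of those of `u`. -/
noncomputable def remainderCoeff (c : PlaneTW → ℝ) : PlaneTW → ℝ :=
  compCoeff c - compCoeff 0 - fatCoeff c

/-- Coefficients of `row - y` in terms of those of the increments `Y l - y`. -/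
noncomputable def rowCoeff (m : Method) (i : ℕ) (w : ℕ → ℝ) (c : ℕ → PlaneTW → ℝ) :
    PlaneTW → ℝ :=
  w 1 • m.psiCoeff i 1 (m.g i 1) (compCoeff 0) +
    ∑ j ∈ Finset.Icc 2 i, w j • m.psiCoeff i j (m.g i j)
      ((fwdDiff 1)^[j - 1] (fun l => remainderCoeff (c l)) 0)

/-- Coefficients of `stagesUpTo - y`. -/
noncomputable def stagesCoeff (m : Method) : ℕ → ℕ → PlaneTW → ℝ
  | 0 => fun _ => 0
  | n + 1 => Function.update (m.stagesCoeff n) (n + 1)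
      (m.rowCoeff (n + 1) (m.a (n + 1)) (m.stagesCoeff n))

/-- Coefficients of `step - y` over plane trees. -/
noncomputable def stepCoeff (m : Method) : PlaneTW → ℝ :=
  m.rowCoeff m.s m.b fun l => m.stagesCoeff l l

variable {E : Type*} [NormedAddCommGroup E] [NormedSpace ℝ E] [CompleteSpace E]
  {f : E → E} {A : E →L[ℝ] E} {y : E}

theorem hasPlaneSeries_psi (m : Method) (i j : ℕ) (γ : ℝ) {c : PlaneTW → ℝ} {u : ℝ → E}
    (hu : HasPlaneSeries c f A y u) :
    HasPlaneSeries (m.psiCoeff i j γ c) f A y fun h => m.psi i j ((γ * h) • A) (u h) := by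
  have := HasPlaneSeries.sum (Finset.Icc 1 m.s) fun k _ => (hu.phi k γ).const_smul (m.p i j k)
  simpa only [psiCoeff, psi, FunLike.coe_sum, Finset.sum_apply, FunLike.coe_smul,
    Pi.smul_apply] using this

theorem hasPlaneSeries_remainder (hf : ContDiffAt ℝ ∞ f y) {c : PlaneTW → ℝ} {Y : ℝ → E}
    (hY : HasPlaneSeries c f A y fun h => Y h - y) :
    HasPlaneSeries (remainderCoeff c) f A y fun h => h • remainder f A y (Y h) := by
  have := ((hY.comp hf).sub (HasPlaneSeries.zero.comp hf)).sub hY.fat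
  simpa only [remainderCoeff, remainder, smul_sub, add_sub_cancel, add_zero, FunLike.coe_smul,
    Pi.smul_apply] using this

theorem hasPlaneSeries_row (m : Method) (hf : ContDiffAt ℝ ∞ f y) (i : ℕ) (w : ℕ → ℝ)
    {c : ℕ → PlaneTW → ℝ} {Y : ℝ → ℕ → E}
    (hY : ∀ l, HasPlaneSeries (c l) f A y fun h => Y h l - y) :
    HasPlaneSeries (m.rowCoeff i w c) f A y fun h => m.row f A y h i w (Y h) - y := by
  -- For `u = 0` only the empty product survives, so `compCoeff 0` is supported on the single meagre
  -- node.
  have h0 : HasPlaneSeries (compCoeff 0) f A y fun h => h • f y := by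
    simpa only [add_zero] using HasPlaneSeries.zero.comp (A := A) hf
  have hr := HasPlaneSeries.fwdDiff_iterate fun l => hasPlaneSeries_remainder hf (hY l)
  have := ((m.hasPlaneSeries_psi i 1 (m.g i 1) h0).const_smul (w 1)).add
    (HasPlaneSeries.sum (Finset.Icc 2 i) fun j _ =>
      (m.hasPlaneSeries_psi i j (m.g i j) (hr (j - 1) 0)).const_smul (w j))
  unfold rowCoeff
  convert this using 1
  funext h
  -- The plane series is available for `h r(Y_l)`, whereas the method multiplies by `h` after taking
  -- differences.
  have hs : ∀ j, (fwdDiff 1)^[j] (fun l => h • remainder f A y (Y h l)) 0 =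
      h • (fwdDiff 1)^[j] (fun l => remainder f A y (Y h l)) 0 := fun j =>
    congrFun (fwdDiff_iter_const_smul 1 h _ j) 0
  simp only [row, hs]
  abel

/-- Indices `l > n` are included, with increment and coefficients still zero there, so that the row
rule applies to the whole sequence. -/
theorem hasPlaneSeries_stagesUpTo (m : Method) (hf : ContDiffAt ℝ ∞ f y) (n : ℕ) : ∀ l,
    HasPlaneSeries (m.stagesCoeff n l) f A y fun h => m.stagesUpTo f A y h n l - y := by
  induction n with
  | zero =>
    intro l
    simpa only [stagesCoeff, stagesUpTo, sub_self] using HasPlaneSeries.zero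
  | succ n ih =>
    intro l
    rcases eq_or_ne l (n + 1) with rfl | hl
    · simpa only [stagesCoeff, stagesUpTo, Function.update_self] using
        m.hasPlaneSeries_row hf (n + 1) (m.a (n + 1)) ih
    · simpa only [stagesCoeff, stagesUpTo, Function.update_of_ne hl] using ih l

theorem hasPlaneSeries_step (m : Method) (hf : ContDiffAt ℝ ∞ f y) :
    HasPlaneSeries m.stepCoeff f A y fun h => m.step f A y h - y :=
  m.hasPlaneSeries_row hf m.s m.b fun l => m.hasPlaneSeries_stagesUpTo hf l l

end Method

/-! ## From plane trees to TW-trees -/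

open Classical in
/-- The B-series coefficients belonging to a series over plane trees. -/
noncomputable def bCoeff (c : PlaneTW → ℝ) : Option TW → ℝ
  | none => 1
  | some τ => τ.symm * ∑ t ∈ (PlaneTW.orderLE τ.order).filter (fun t => (⟦t⟧ : TW) = τ), c t

/-- The factor `σ(τ)` in `bCoeff` cancels the one in the B-series, so the plane orderings of a tree
need not be counted. -/
theorem truncBSeries_bCoeff {E : Type*} [NormedAddCommGroup E] [NormedSpace ℝ E]
    {f : E → E} {y : E} (hf : ContDiffAt ℝ ∞ f y) (A : E →L[ℝ] E) (c : PlaneTW → ℝ) (p : ℕ)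
    (h : ℝ) : truncBSeries Set.univ (bCoeff c) f A y p h = y + planeSum c f A y p h := by
  classical
  rw [truncBSeries_univ, bCoeff, one_smul, planeSum, ← Finset.sum_fiberwise_of_maps_to
    (t := TW.orderLE p) (g := fun t => (⟦t⟧ : TW))]
  · congr 1
    refine Finset.sum_congr rfl fun τ hτ => ?_
    have hs : (τ.symm : ℝ) ≠ 0 := by exact_mod_cast τ.symm_pos.ne'
    have hτp : τ.order ≤ p := TW.mem_orderLE.1 hτ
    rw [bCoeff, mul_assoc, mul_div_cancel_left₀ _ hs, Finset.sum_mul, Finset.sum_smul]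
    refine Finset.sum_congr ?_ fun t ht => ?_
    · ext t
      simp only [Finset.mem_filter, PlaneTW.mem_orderLE]
      refine and_congr_left fun ht => ?_
      rw [← ht, TW.order_mk] at hτp ⊢
      simpa using hτp
    · rw [← (Finset.mem_filter.1 ht).2, TW.order_mk, TW.elemDiff_mk hf]
  · intro t ht
    exact TW.mem_orderLE.2 (PlaneTW.mem_orderLE.1 ht)

theorem HasPlaneSeries.hasBSeries {E : Type*} [NormedAddCommGroup E] [NormedSpace ℝ E]
    {f : E → E} {A : E →L[ℝ] E} {y : E} (hf : ContDiffAt ℝ ∞ f y) {c : PlaneTW → ℝ} {u : ℝ → E}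
    (hu : HasPlaneSeries c f A y fun h => u h - y) :
    HasBSeries Set.univ (bCoeff c) f A y u := fun p => by
  simpa only [truncBSeries_bCoeff hf, sub_add_eq_sub_sub] using hu p

end EPIRK

/-! ### B-series of the step for general and for Krylov matrices -/

theorem mainTheorem1 (m : Method) :
    ∃ a : Option TW → ℝ,
      (∀ (N : ℕ) (f : EuclideanSpace ℝ (Fin N) → EuclideanSpace ℝ (Fin N))
        (y : EuclideanSpace ℝ (Fin N))
        (A : EuclideanSpace ℝ (Fin N) →L[ℝ] EuclideanSpace ℝ (Fin N)),
        ContDiffAt ℝ ∞ f y → HasBSeries Set.univ a f A y (m.step f A y)) ∧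
      ∀ M : ℕ,
        (∀ (N : ℕ) (f : EuclideanSpace ℝ (Fin N) → EuclideanSpace ℝ (Fin N))
          (y : EuclideanSpace ℝ (Fin N))
          (V : EuclideanSpace ℝ (Fin M) →L[ℝ] EuclideanSpace ℝ (Fin N)),
          ContDiffAt ℝ ∞ f y → IsKrylovBasis (fderiv ℝ f y) (f y) V →
            HasBSeries (TW.TK M) (mergedCoeff M a) f (krylovJacobian (fderiv ℝ f y) V) y
              (m.step f (krylovJacobian (fderiv ℝ f y) V) y) ∧
            ∀ τ : TW, (τ.recolour M).elemDiff f (krylovJacobian (fderiv ℝ f y) V) y =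
              τ.elemDiff f (krylovJacobian (fderiv ℝ f y) V) y) ∧
        (∀ τ : TW, τ.recolour M ∈ TW.TK M) ∧
        (∀ τ : TW, τ ∈ TW.TK M ↔ τ.recolour M = τ) ∧
        ∀ τ : TW, τ.IsLinear → τ.order ≤ M → (τ.recolour M).AllMeagre := by
  have hB : ∀ (N : ℕ) (f : EuclideanSpace ℝ (Fin N) → EuclideanSpace ℝ (Fin N))
      (y : EuclideanSpace ℝ (Fin N))
      (A : EuclideanSpace ℝ (Fin N) →L[ℝ] EuclideanSpace ℝ (Fin N)), ContDiffAt ℝ ∞ f y →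
      HasBSeries Set.univ (bCoeff m.stepCoeff) f A y (m.step f A y) := fun N f y A hf =>
    (m.hasPlaneSeries_step hf).hasBSeries hf
  refine ⟨bCoeff m.stepCoeff, hB, fun M => ⟨fun N f y V hf hV => ?_, TW.recolour_mem_TK M,
    TW.mem_TK_iff M, fun τ => TW.IsLinear.allMeagre_recolour⟩⟩
  have hF := TW.elemDiff_recolour (M := M) hf (krylovJacobian_apply_pow hV)
  refine ⟨fun p => ?_, hF⟩
  -- The merged and the full truncations are equal for every `h`, so the error estimate carries over
  -- unchanged.
  simpa only [truncBSeries_mergedCoeff hF] using hB N f y _ hf p
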